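/- Let $r\ge 0$ and $n_1,\dots,n_r\ge 1$ be integers, and let $G=K_{n_1}\times\cdots\times K_{n_r}$ be the Cartesian product of complete graphs: its vertices are the $r$-tuples $(j_1,\dots,j_r)\in[n_1]\times\cdots\times[n_r]$, and two vertices are adjacent if and only if they differ in exactly one coordinate. An edge is said to lie in direction $i$ if its two endpoints differ in their $i$-th coordinate. Take indeterminates $q_i$ ($1\le i\le r$) and $x^{(i)}_j$ ($1\le i\le r$, $1\le j\le n_i$). For a spanning tree $T$ of $G$ put $$q^{\mathrm{dir}(T)}=\prod_{i=1}^r q_i^{|\{\text{edges of }T\text{ in direction }i\}|},\qquad x^{\mathrm{dd}(T)}=\prod_{v=(j_1,\dots,j_r)}\bigl(x^{(1)}_{j_1}\cdots x^{(r)}_{j_r}\bigr)^{\deg_T(v)},$$ where $v$ runs over all vertices of $G$, and let $$f=\sum_{T} q^{\mathrm{dir}(T)}\,x^{\mathrm{dd}(T)}\in\mathbb{Z}\bigl[q_i,x^{(i)}_j\bigr],$$ where $T$ runs over all spanning trees of $G$. Then, in the ring $\mathbb{Z}[q_i,x^{(i)}_j]$: 1. for every $i$, $f$ is divisible by $q_i^{\,n_i-1}$;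 2. if $G$ has more than one vertex (that is, $n_k\ge 2$ for some $k$), then for every $i$ and every $j\in[n_i]$, $f$ is divisible by $\bigl(x^{(i)}_j\bigr)^{\prod_{k\ne i}n_k}$; 3. for every $i$, $f$ is divisible by $\bigl(x^{(i)}_1+\cdots+x^{(i)}_{n_i}\bigr)^{\max(n_i-2,\,0)}$. -/

import Mathlib

open Finset MvPolynomial

namespace ProductTrees

/-- The Cartesian (box) product of a family of graphs: two tuples are adjacent when they are
adjacent in one coordinate and equal in all the others. -/
def piBoxProd {ι : Type*} {V : ι → Type*} (G : ∀ i, SimpleGraph (V i)) :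
    SimpleGraph (∀ i, V i) where
  Adj u v := ∃ i, (G i).Adj (u i) (v i) ∧ ∀ k, k ≠ i → u k = v k
  symm := ⟨fun _ _ ⟨i, h, hk⟩ => ⟨i, h.symm, fun k hki => (hk k hki).symm⟩⟩
  loopless := ⟨fun _ ⟨_, h, _⟩ => h.ne rfl⟩

/-- A vertex of `K_{n_1} × ⋯ × K_{n_r}`: an `r`-tuple whose `i`-th entry lies in an `n_i`-set. -/
abbrev Vertex {r : ℕ} (n : Fin r → ℕ) : Type := ∀ i : Fin r, Fin (n i)

/-- The Cartesian product `K_{n_1} × ⋯ × K_{n_r}` of complete graphs. -/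
def prodComplete {r : ℕ} (n : Fin r → ℕ) : SimpleGraph (Vertex n) :=
  piBoxProd fun i => (⊤ : SimpleGraph (Fin (n i)))

/-- The spanning trees of a finite graph `G`, as graphs on the same vertex set. -/
noncomputable def spanningTrees {V : Type*} [Finite V] (G : SimpleGraph V) :
    Finset (SimpleGraph V) :=
  (Set.toFinite {T : SimpleGraph V | T ≤ G ∧ T.IsTree}).toFinset

/-- An edge lies in direction `i` if its two endpoints differ in their `i`-th coordinate. -/
def InDirection {r : ℕ} {n : Fin r → ℕ} (i : Fin r) (e : Sym2 (Vertex n)) : Prop :=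
  ∃ u v : Vertex n, e = s(u, v) ∧ u i ≠ v i

/-- The variables: one `q_i` for each direction `i`, and one `x_j^{(i)}` for each direction `i`
and each `j` in the `n_i`-set. -/
abbrev Var {r : ℕ} (n : Fin r → ℕ) : Type := Fin r ⊕ (Σ i : Fin r, Fin (n i))

/-- The variable `q_i`. -/
noncomputable def q {r : ℕ} (n : Fin r → ℕ) (i : Fin r) : MvPolynomial (Var n) ℤ :=
  X (Sum.inl i)

/-- The variable `x_j^{(i)}`. -/
noncomputable def x {r : ℕ} (n : Fin r → ℕ) (i : Fin r) (j : Fin (n i)) :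
    MvPolynomial (Var n) ℤ :=
  X (Sum.inr ⟨i, j⟩)

/-- The direction monomial `q^{dir(T)}`. -/
noncomputable def dirMonomial {r : ℕ} {n : Fin r → ℕ} (T : SimpleGraph (Vertex n)) :
    MvPolynomial (Var n) ℤ :=
  ∏ i : Fin r, q n i ^ {e : Sym2 (Vertex n) | e ∈ T.edgeSet ∧ InDirection i e}.ncard

open Classical in
/-- The decoupled degree monomial `x^{dd(T)}`. -/
noncomputable def ddMonomial {r : ℕ} {n : Fin r → ℕ} (T : SimpleGraph (Vertex n)) :
    MvPolynomial (Var n) ℤ :=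
  ∏ v : Vertex n, (∏ i : Fin r, x n i (v i)) ^ T.degree v

/-- The spanning tree enumerator `f_{n_1,…,n_r}(q, x)`. -/
noncomputable def enumerator {r : ℕ} (n : Fin r → ℕ) : MvPolynomial (Var n) ℤ :=
  ∑ T ∈ spanningTrees (prodComplete n), dirMonomial T * ddMonomial T

end ProductTrees

/-!
For a spanning tree `T`, projecting to the `i`-th coordinate maps the edges of `T` in direction `i`
onto the edges of a connected graph on `n i` vertices, so there are at least `n i - 1` of them
(`sub_one_le_ncard_inDirection`). Every vertex of `T` has positive degree as soon as there are two
vertices, so each of the vertices with `i`-th coordinate `j` contributes a factor `x n i j`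
(`pow_dvd_ddMonomial`). The first two divisibilities thus hold tree by tree.

The third one holds only for the sum, and comes from a weighted matrix-tree theorem. The summand of
`T` is the product over the edges `uv` of `T`, in direction `k` say, of `q n k * X_u * X_v`, where
`X_v = ∏ i, x n i (v i)`; hence the enumerator is the determinant of a reduced weighted Laplacian
`L` (`enumerator_eq_det`). If a function `g` depends only on the `i`-th coordinate, `g v = c (v i)`,
and `∑ j, x n i j * c j = 0`, then `L g` is a multiple of `s = ∑ j, x n i j`
(`sum_edgeWeight_mul_sub`). The functions `g` that moreover vanish at the removed vertex form a
family of rank `n i - 2`. Writing a basis of it into columns of a matrix `P` whose determinant is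
`x n i j₁ ^ (n i - 2)` shows that `s ^ (n i - 2)` divides `x n i j₁ ^ (n i - 2) * det L`, and the
variable `x n i j₁` is a prime which does not divide `s`.

The matrix-tree theorem is proved by expanding the determinant along its rows: this gives a sum over
all maps `p` from the vertices other than the root `r` to the vertices, each weighted by the
determinant of `1 - A` for the adjacency matrix `A` of the functional graph of `p`. That determinant
is `1` if iterating `p` always leads to `r` and `0` otherwise, and the maps of the first kind are
the parent maps of the trees rooted at `r`.
-/

namespace ProductTrees

/-! ### Rooted trees and their parent maps -/

section MatrixTree

variable {V : Type*} {r : V}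

/-- `p`, defined away from the root `r`, leads every vertex to `r` after finitely many steps. This
is encoded as well-foundedness of the relation `p b = a` between `a` and `b`, which gives induction
along `p` from the root upwards. -/
def IsRootward (p : {v // v ≠ r} → V) : Prop :=
  WellFounded fun a b => ∃ hb : b ≠ r, p ⟨b, hb⟩ = a

lemma IsRootward.ne {p : {v // v ≠ r} → V} (hp : IsRootward p) (v : {v // v ≠ r}) :
    p v ≠ v := fun h => hp.irrefl.irrefl v.1 ⟨v.2, h⟩

/-- A rootward map has no cycle of length two. -/
lemma IsRootward.apply_apply_ne {p : {v // v ≠ r} → V} (hp : IsRootward p) (v : {v // v ≠ r})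
    (h : p v ≠ r) : p ⟨p v, h⟩ ≠ v := fun h' =>
  hp.asymmetric (a := v.1) (b := p v) ⟨h, h'⟩ ⟨v.2, rfl⟩

/-- The graph whose edges join each vertex `v ≠ r` to its parent `p v`. -/
def parentGraph (p : {v // v ≠ r} → V) : SimpleGraph V :=
  SimpleGraph.fromEdgeSet (Set.range fun v => s(v.1, p v))

namespace IsRootward
variable {p p' : {v // v ≠ r} → V}

lemma edgeSet_parentGraph (hp : IsRootward p) :
    (parentGraph p).edgeSet = Set.range fun v => s(v.1, p v) := by
  rw [parentGraph, SimpleGraph.edgeSet_fromEdgeSet, sdiff_eq_left, Set.disjoint_left]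
  rintro _ ⟨v, rfl⟩ h
  exact hp.ne v (Eq.symm (by simpa using h))

lemma adj_parentGraph (hp : IsRootward p) (v : {v // v ≠ r}) : (parentGraph p).Adj v (p v) := by
  rw [← SimpleGraph.mem_edgeSet, hp.edgeSet_parentGraph]
  exact ⟨v, rfl⟩

lemma injective_edge (hp : IsRootward p) :
    Function.Injective fun v : {v // v ≠ r} => s(v.1, p v) := by
  intro u v huv
  by_contra hne
  have hne' : u.1 ≠ v.1 := fun h => hne (Subtype.ext h)
  have h : u.1 = p v ∧ p u = v.1 := by simpa [hne'] using huv
  have hr : p v ≠ r := h.1 ▸ u.2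
  refine hp.apply_apply_ne v hr ?_
  rw [← h.2]
  congr 1
  exact Subtype.ext h.1.symm

lemma connected_parentGraph (hp : IsRootward p) : (parentGraph p).Connected := by
  have h : ∀ v, (parentGraph p).Reachable v r := fun v => by
    induction v using hp.induction with
    | _ v ih =>
      by_cases hv : v = r
      · rw [hv]
      · exact (hp.adj_parentGraph ⟨v, hv⟩).reachable.trans (ih _ ⟨hv, rfl⟩)
  exact { preconnected := fun u v => (h u).trans (h v).symm, nonempty := ⟨r⟩ }

lemma isTree_parentGraph [Finite V] (hp : IsRootward p) : (parentGraph p).IsTree := by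
  classical
  have := Fintype.ofFinite V
  rw [SimpleGraph.isTree_iff_connected_and_card]
  refine ⟨hp.connected_parentGraph, ?_⟩
  rw [hp.edgeSet_parentGraph, Nat.card_range_of_injective hp.injective_edge,
    Nat.card_eq_fintype_card, Fintype.card_subtype_compl, Fintype.card_subtype_eq,
    Nat.card_eq_fintype_card,
    Nat.sub_add_cancel (Fintype.card_pos_iff.2 ⟨r⟩)]

/-- A rootward map is determined by its graph: by induction from the root, the edge from `v` to
`p' v` cannot be the one that joins `p' v` to its own parent. -/
lemma eq_of_parentGraph_eq (hp : IsRootward p) (hp' : IsRootward p')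
    (h : parentGraph p = parentGraph p') : p = p' := by
  have key : ∀ v, ∀ hv : v ≠ r, p ⟨v, hv⟩ = p' ⟨v, hv⟩ := fun v => by
    induction v using hp'.induction with
    | _ v ih =>
      intro hv
      have hadj : s(v, p' ⟨v, hv⟩) ∈ (parentGraph p).edgeSet := h ▸ hp'.adj_parentGraph ⟨v, hv⟩
      rw [hp.edgeSet_parentGraph] at hadj
      obtain ⟨u, hu⟩ := hadj
      rcases Sym2.eq_iff.1 hu with ⟨h1, h2⟩ | ⟨h1, h2⟩
      · rw [← h2]
        congr 1
        exact Subtype.ext h1.symm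
      · have hr : p' ⟨v, hv⟩ ≠ r := h1 ▸ u.2
        have hu' : u = ⟨p' ⟨v, hv⟩, hr⟩ := Subtype.ext h1
        rw [hu', ih _ ⟨hv, rfl⟩ hr] at h2
        exact absurd h2 (hp'.apply_apply_ne ⟨v, hv⟩ hr)
  exact funext fun v => key v.1 v.2

end IsRootward

/-- Every tree is the graph of a rootward map, which sends `v` to a neighbour closer to `r`. -/
lemma exists_isRootward_of_isTree {T : SimpleGraph V} (hT : T.IsTree) (r : V) :
    ∃ p : {v // v ≠ r} → V, IsRootward p ∧ parentGraph p = T := by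
  have h : ∀ v : {v // v ≠ r}, ∃ u, T.Adj v u ∧ T.dist u r < T.dist v r := by
    rintro ⟨v, hv⟩
    obtain ⟨W, hW⟩ := hT.connected.exists_walk_length_eq_dist v r
    cases W with
    | nil => exact absurd rfl hv
    | cons hadj W' =>
      refine ⟨_, hadj, ?_⟩
      rw [SimpleGraph.Walk.length_cons] at hW
      have := SimpleGraph.dist_le W'
      simp only
      omega
  choose p hadj hlt using h
  have hp : IsRootward p := by
    refine Subrelation.wf (r := InvImage (· < ·) fun v => T.dist v r) ?_
      (InvImage.wf _ wellFounded_lt)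
    rintro a b ⟨hb, rfl⟩
    exact hlt ⟨b, hb⟩
  refine ⟨p, hp, ?_⟩
  have hle : parentGraph p ≤ T := by
    rw [← SimpleGraph.edgeSet_subset_edgeSet, hp.edgeSet_parentGraph]
    rintro _ ⟨v, rfl⟩
    exact hadj v
  -- A tree is a minimal connected graph, so the connected subgraph `parentGraph p` is all of `T`.
  exact hle.antisymm ((SimpleGraph.isTree_iff_minimal_connected.1 hT).2
    hp.connected_parentGraph hle)

lemma prod_edgeFinset_parentGraph [Fintype V] [DecidableEq V] {R : Type*} [CommMonoid R]
    {p : {v // v ≠ r} → V} (hp : IsRootward p)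
    [Fintype (parentGraph p).edgeSet] (W : Sym2 V → R) :
    ∏ e ∈ (parentGraph p).edgeFinset, W e = ∏ v, W s(v.1, p v) := by
  have : (parentGraph p).edgeFinset = univ.image fun v => s(v.1, p v) := by
    ext e
    simp [hp.edgeSet_parentGraph]
  rw [this, Finset.prod_image fun u _ v _ h => hp.injective_edge h]

/-! ### The weighted matrix-tree theorem -/

variable [DecidableEq V] {R : Type*} [CommRing R]

/-- The matrix `1 - A`, where `A` is the adjacency matrix of the functional graph of `p` with the
row and the column of the root `r` removed. -/
def parentMatrix (R : Type*) [CommRing R] (p : {v // v ≠ r} → V) :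
    Matrix {v // v ≠ r} {v // v ≠ r} R :=
  Matrix.of fun u v => (if u = v then 1 else 0) - (if p u = v then 1 else 0)

variable [Fintype V]

/-- Ordered by their rank in the well-founded relation, the vertices make `1 - A` unitriangular. -/
lemma det_parentMatrix_of_isRootward {p : {v // v ≠ r} → V} (hp : IsRootward p) :
    (parentMatrix R p).det = 1 := by
  have := (isWellFounded_iff _ _).2 hp
  obtain ⟨h, hlt⟩ : ∃ h : V → Ordinal, ∀ u, h (p u) < h u.1 :=
    ⟨IsWellFounded.rank fun a b => ∃ hb : b ≠ r, p ⟨b, hb⟩ = a, fun u =>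
      IsWellFounded.rank_lt_of_rel ⟨u.2, rfl⟩⟩
  have hT : (parentMatrix R p).BlockTriangular (fun u => OrderDual.toDual (h u.1)) := by
    intro u v huv
    have huv' : h u.1 < h v.1 := huv
    have h1 : u ≠ v := by rintro rfl; exact lt_irrefl _ huv'
    have h2 : p u ≠ v := fun e => lt_asymm (e ▸ hlt u) huv'
    simp [parentMatrix, h1, h2]
  rw [hT.det]
  refine Finset.prod_eq_one fun a _ => ?_
  have : (parentMatrix R p).toSquareBlock (fun u => OrderDual.toDual (h u.1)) a = 1 := by
    ext ⟨u, hu⟩ ⟨v, hv⟩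
    have e : h u.1 = h v.1 := OrderDual.toDual.injective (hu.trans hv.symm)
    have h2 : p u ≠ v := fun e' => (e' ▸ hlt u).ne e.symm
    simp [parentMatrix, Matrix.toSquareBlock_def, h2, Matrix.one_apply]
  rw [this, Matrix.det_one]

/-- The indicator function of the vertices from which `r` is never reached is in the kernel. -/
lemma det_parentMatrix_of_not_isRootward {p : {v // v ≠ r} → V} (hp : ¬ IsRootward p) :
    (parentMatrix R p).det = 0 := by
  classical
  -- A kernel vector forces the determinant to vanish over a domain only, hence the detour via `ℤ`.
  have hZ : (parentMatrix ℤ p).det = 0 := by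
    set rel : V → V → Prop := fun a b => ∃ hb : b ≠ r, p ⟨b, hb⟩ = a with hrel
    have hroot : Acc rel r := ⟨r, fun a ⟨hb, _⟩ => absurd rfl hb⟩
    have hstep : ∀ v : {v // v ≠ r}, Acc rel v ↔ Acc rel (p v) := fun v =>
      ⟨fun h => h.inv ⟨v.2, rfl⟩, fun h => ⟨v.1, by rintro a ⟨-, rfl⟩; exact h⟩⟩
    obtain ⟨c, hc⟩ : ∃ c, ¬ Acc rel c := by
      by_contra! h
      exact hp ⟨h⟩
    have hcr : c ≠ r := by rintro rfl; exact hc hroot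
    refine Matrix.exists_mulVec_eq_zero_iff.1
      ⟨fun v => if Acc rel v then 0 else 1, fun h => ?_, ?_⟩
    · simpa [hc] using congrFun h ⟨c, hcr⟩
    · ext u
      simp only [parentMatrix, Matrix.mulVec, dotProduct, Matrix.of_apply, sub_mul, ite_mul,
        one_mul, zero_mul, Finset.sum_sub_distrib, Finset.sum_ite_eq, Finset.mem_univ, if_true,
        Pi.zero_apply]
      by_cases hu : p u = r
      · rw [if_pos ((hstep u).2 (hu ▸ hroot)), Finset.sum_eq_zero, sub_zero]
        exact fun v _ => if_neg fun h => v.2 (h.symm.trans hu)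
      · rw [Finset.sum_eq_single ⟨p u, hu⟩]
        · simp [hstep u]
        · exact fun v _ hv => if_neg fun h => hv (Subtype.ext h.symm)
        · simp
  have : parentMatrix R p = (parentMatrix ℤ p).map (Int.castRingHom R) := by
    ext u v
    simp only [parentMatrix, Matrix.map_apply, Matrix.of_apply]
    split_ifs <;> simp
  rw [this, ← RingHom.mapMatrix_apply, ← RingHom.map_det, hZ, map_zero]

/-- The Laplacian of the weights `w`, with the row and the column of `r` removed. The diagonal
weight `w u u` occurs both in the row sum and in the subtracted term, and so cancels. -/
def reducedLaplacian (w : V → V → R) (r : V) : Matrix {v // v ≠ r} {v // v ≠ r} R :=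
  Matrix.of fun u v => (if u = v then ∑ z, w u z else 0) - w u v

/-- The row of `u` is `∑ z, w u z • (e_u - e_z)`, with `e_r = 0`; expand the determinant by
multilinearity. -/
theorem det_reducedLaplacian_eq_sum (w : V → V → R) :
    (reducedLaplacian w r).det =
      ∑ p : {v // v ≠ r} → V, (∏ v, w v.1 (p v)) * (parentMatrix R p).det := by
  have h : reducedLaplacian w r =
      fun u : {v // v ≠ r} => ∑ z, w u z • fun v : {v // v ≠ r} =>
        ((if u = v then 1 else 0) - (if z = v then 1 else 0) : R) := by
    ext u v
    simp only [reducedLaplacian, Matrix.of_apply, Finset.sum_apply, Pi.smul_apply, smul_eq_mul,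
      mul_sub, Finset.sum_sub_distrib, mul_ite, mul_one, mul_zero]
    congr 1
    · split_ifs <;> simp
    · simp
  change Matrix.detRowAlternating.toMultilinearMap (reducedLaplacian w r) = _
  rw [h, MultilinearMap.map_sum]
  refine Finset.sum_congr rfl fun p _ => ?_
  rw [MultilinearMap.map_smul_univ]
  rfl

open Classical in
theorem det_reducedLaplacian_eq_sum_isRootward (w : V → V → R) :
    (reducedLaplacian w r).det =
      ∑ p : {v // v ≠ r} → V with IsRootward p, ∏ v, w v.1 (p v) := by
  rw [det_reducedLaplacian_eq_sum, Finset.sum_filter]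
  refine Finset.sum_congr rfl fun p _ => ?_
  split_ifs with hp
  · rw [det_parentMatrix_of_isRootward hp, mul_one]
  · rw [det_parentMatrix_of_not_isRootward hp, mul_zero]

end MatrixTree

open Classical in
/-- The **weighted matrix-tree theorem**: a reduced Laplacian of symmetric edge weights supported on
`G` has the weighted count of the spanning trees of `G` as its determinant. -/
theorem det_reducedLaplacian_eq_sum_spanningTrees {V : Type*} [Fintype V] [DecidableEq V]
    {R : Type*} [CommRing R]
    (G : SimpleGraph V) (W : Sym2 V → R) (hW : ∀ e ∉ G.edgeSet, W e = 0) (r : V) :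
    (reducedLaplacian (fun u v => W s(u, v)) r).det =
      ∑ T ∈ spanningTrees G, ∏ e ∈ T.edgeFinset, W e := by
  have h : ∑ T ∈ spanningTrees G, ∏ e ∈ T.edgeFinset, W e =
      ∑ T : SimpleGraph V with T.IsTree, ∏ e ∈ T.edgeFinset, W e := by
    refine Finset.sum_subset (fun T hT => ?_) fun T hT hT' => ?_
    · simp only [spanningTrees, Set.Finite.mem_toFinset, Set.mem_ofPred_eq] at hT
      simpa using hT.2
    · have hle : ¬ T ≤ G := fun hle => hT' (by
        simpa [spanningTrees] using And.intro hle (Finset.mem_filter.1 hT).2)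
      rw [← SimpleGraph.edgeSet_subset_edgeSet, Set.not_subset] at hle
      obtain ⟨e, he, heG⟩ := hle
      exact Finset.prod_eq_zero (by simpa using he) (hW e heG)
  rw [h, det_reducedLaplacian_eq_sum_isRootward]
  refine Finset.sum_bij (fun p _ => parentGraph p) ?_ ?_ ?_ ?_
  · intro p hp
    simpa using (Finset.mem_filter.1 hp).2.isTree_parentGraph
  · intro p hp p' hp'
    exact (Finset.mem_filter.1 hp).2.eq_of_parentGraph_eq (Finset.mem_filter.1 hp').2
  · intro T hT
    obtain ⟨p, hp, rfl⟩ := exists_isRootward_of_isTree (Finset.mem_filter.1 hT).2 r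
    exact ⟨p, by simpa using hp, rfl⟩
  · intro p hp
    rw [prod_edgeFinset_parentGraph (Finset.mem_filter.1 hp).2]

/-! ### Images under the Laplacian and common factors of columns -/

lemma reducedLaplacian_mulVec {V : Type*} [Fintype V] [DecidableEq V] {R : Type*} [CommRing R]
    (w : V → V → R) {r : V} (g : V → R) (hg : g r = 0) (u : {v // v ≠ r}) :
    (reducedLaplacian w r).mulVec (fun v => g v) u = ∑ z, w u z * (g u - g z) := by
  have h : ∑ v : {v // v ≠ r}, w u v * g v = ∑ z, w u z * g z := by
    rw [← Finset.sum_subtype (univ.erase r) (by simp) (fun z => w u z * g z),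
      Finset.sum_erase _ (by rw [hg, mul_zero])]
  simp [reducedLaplacian, Matrix.mulVec, dotProduct, sub_mul, mul_sub, Finset.sum_sub_distrib, h,
    ite_mul, Finset.sum_mul]

lemma pow_card_dvd_det {m R : Type*} [Fintype m] [DecidableEq m] [CommRing R] (M : Matrix m m R)
    (J : Finset m) (s : R) (h : ∀ v ∈ J, ∀ u, s ∣ M u v) : s ^ #J ∣ M.det := by
  have h' : ∀ u v, ∃ a, M u v = (if v ∈ J then s else 1) * a := fun u v => by
    split_ifs with hv
    · exact h v hv u
    · exact ⟨M u v, (one_mul _).symm⟩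
  choose N hN using h'
  have hM : M = Matrix.of fun u v => (if v ∈ J then s else 1) * N u v := by
    ext u v
    exact hN u v
  have hdet := Matrix.det_mul_row (fun v => if v ∈ J then s else 1) (Matrix.of N)
  simp only [Matrix.of_apply] at hdet
  rw [hM, hdet, Finset.prod_ite_mem, Finset.univ_inter, Finset.prod_const]
  exact dvd_mul_right _ _

/-! ### The enumerator as a determinant -/

section Enumerator
variable {r : ℕ} {n : Fin r → ℕ}

/-- The monomial `x_{j_1}^{(1)} ⋯ x_{j_r}^{(r)}` of the vertex `v = (j_1, …, j_r)`. -/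
noncomputable def vertexMonomial (v : Vertex n) : MvPolynomial (Var n) ℤ :=
  ∏ i, x n i (v i)

open Classical in
/-- The weight `q_i X_u X_v` of an edge `uv` in direction `i`, where `X_v = vertexMonomial v`, and
`0` for a pair which is not an edge. The products over directions and vertices serve to define it on
unordered pairs without choosing endpoints. -/
noncomputable def edgeWeight (n : Fin r → ℕ) (e : Sym2 (Vertex n)) : MvPolynomial (Var n) ℤ :=
  if e ∈ (prodComplete n).edgeSet then
    (∏ i, if InDirection i e then q n i else 1) * ∏ v, if v ∈ e then vertexMonomial v else 1
  else 0

lemma inDirection_mk {i : Fin r} {u v : Vertex n} : InDirection i s(u, v) ↔ u i ≠ v i := by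
  constructor
  · rintro ⟨u', v', h, hne⟩
    rcases Sym2.eq_iff.1 h with ⟨rfl, rfl⟩ | ⟨rfl, rfl⟩
    · exact hne
    · exact hne.symm
  · exact fun h => ⟨u, v, rfl, h⟩

lemma prodComplete_adj {u v : Vertex n} :
    (prodComplete n).Adj u v ↔ ∃ i, u i ≠ v i ∧ v = Function.update u i (v i) := by
  refine exists_congr fun i => and_congr Iff.rfl ?_
  rw [Function.eq_update_iff]
  simp only [true_and]
  exact ⟨fun h k hk => (h k hk).symm, fun h k hk => (h k hk).symm⟩

lemma edgeWeight_update (u : Vertex n) (i : Fin r) {j : Fin (n i)} (hj : u i ≠ j) :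
    edgeWeight n s(u, Function.update u i j) =
      q n i * vertexMonomial u * (x n i j * ∏ k ∈ univ.erase i, x n k (u k)) := by
  classical
  have hne : u ≠ Function.update u i j := fun h => hj (by
    conv_lhs => rw [h]
    simp)
  have hadj : (prodComplete n).Adj u (Function.update u i j) :=
    prodComplete_adj.2 ⟨i, by simpa using hj, by simp⟩
  have h1 : (∏ k, if InDirection k s(u, Function.update u i j) then q n k else 1) = q n i := by
    rw [Finset.prod_eq_single i]
    · rw [if_pos (inDirection_mk.2 (by simpa using hj))]
    · intro k _ hk
      rw [if_neg]
      simp [inDirection_mk, hk]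
    · simp
  have h2 : (∏ v, if v ∈ s(u, Function.update u i j) then vertexMonomial v else 1) =
      vertexMonomial u * vertexMonomial (Function.update u i j) := by
    rw [← Finset.prod_filter, ← Finset.prod_pair hne]
    congr 1
    ext v
    simp
  have h3 : vertexMonomial (Function.update u i j) =
      x n i j * ∏ k ∈ univ.erase i, x n k (u k) := by
    rw [vertexMonomial, ← Finset.mul_prod_erase _ _ (Finset.mem_univ i), Function.update_self]
    congr 1
    refine Finset.prod_congr rfl fun k hk => ?_
    rw [Function.update_of_ne (Finset.ne_of_mem_erase hk)]
  rw [edgeWeight, if_pos ((prodComplete n).mem_edgeSet.2 hadj), h1, h2, h3, mul_assoc]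

open Classical in
lemma dirMonomial_mul_ddMonomial {T : SimpleGraph (Vertex n)} (hT : T ≤ prodComplete n) :
    dirMonomial T * ddMonomial T = ∏ e ∈ T.edgeFinset, edgeWeight n e := by
  have h : ∏ e ∈ T.edgeFinset, edgeWeight n e = ∏ e ∈ T.edgeFinset,
      ((∏ i, if InDirection i e then q n i else 1) *
        ∏ v, if v ∈ e then vertexMonomial v else 1) := by
    refine Finset.prod_congr rfl fun e he => ?_
    rw [edgeWeight, if_pos]
    exact SimpleGraph.edgeSet_subset_edgeSet.2 hT (by simpa using he)
  rw [h, Finset.prod_mul_distrib, Finset.prod_comm, Finset.prod_comm (s := T.edgeFinset)]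
  congr 1
  · refine Finset.prod_congr rfl fun i _ => ?_
    rw [← Finset.prod_filter, Finset.prod_const, ← Set.ncard_coe_finset]
    congr 2
    ext e
    simp
  · refine Finset.prod_congr rfl fun v _ => ?_
    rw [← Finset.prod_filter, Finset.prod_const, ← SimpleGraph.card_incidenceFinset_eq_degree,
      SimpleGraph.incidenceFinset_eq_filter, vertexMonomial]

theorem enumerator_eq_det (root : Vertex n) : enumerator n =
    (reducedLaplacian (fun u v => edgeWeight n s(u, v)) root).det := by
  classical
  rw [det_reducedLaplacian_eq_sum_spanningTrees (prodComplete n) (edgeWeight n)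
    fun e he => if_neg he]
  refine Finset.sum_congr rfl fun T hT => ?_
  simp only [spanningTrees, Set.Finite.mem_toFinset, Set.mem_ofPred_eq] at hT
  exact dirMonomial_mul_ddMonomial hT.1

/-- The Laplacian applied to a function of the `i`-th coordinate only: edges in the other directions
do not contribute. If `∑ j, x n i j * c j = 0`, the result is a multiple of `∑ j, x n i j`. -/
lemma sum_edgeWeight_mul_sub (u : Vertex n) (i : Fin r)
    (c : Fin (n i) → MvPolynomial (Var n) ℤ) :
    ∑ z, edgeWeight n s(u, z) * (c (u i) - c (z i)) =
      q n i * vertexMonomial u * (∏ k ∈ univ.erase i, x n k (u k)) *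
        ((∑ j, x n i j) * c (u i) - ∑ j, x n i j * c j) := by
  rw [Finset.sum_mul, ← Finset.sum_sub_distrib, Finset.mul_sum]
  symm
  refine Finset.sum_of_injOn (fun j => Function.update u i j)
    (Function.update_injective u i).injOn (by simp) ?_ ?_
  · intro z _ hz
    by_cases hi : z i = u i
    · rw [hi, sub_self, mul_zero]
    · rw [edgeWeight, if_neg, zero_mul]
      intro hadj
      obtain ⟨k, hk, hz'⟩ := prodComplete_adj.1 hadj
      by_cases hik : i = k
      · subst hik
        exact hz ⟨z i, by simp, hz'.symm⟩
      · exact hi ((congrFun hz' i).trans (Function.update_of_ne hik _ _))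
  · intro j _
    by_cases hj : u i = j
    · simp [hj]
    · simp only [edgeWeight_update u i hj, Function.update_self]
      ring

/-! ### Divisibility of the single summands -/

lemma sub_one_le_ncard_inDirection (hn : ∀ i, 1 ≤ n i) {T : SimpleGraph (Vertex n)}
    (hT : T.Connected) (i : Fin r) :
    n i - 1 ≤ {e : Sym2 (Vertex n) | e ∈ T.edgeSet ∧ InDirection i e}.ncard := by
  set H : SimpleGraph (Fin (n i)) := SimpleGraph.fromEdgeSet
    (Sym2.map (fun v : Vertex n => v i) '' {e | e ∈ T.edgeSet ∧ InDirection i e}) with hH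
  have hreach : ∀ {u v : Vertex n}, T.Reachable u v → H.Reachable (u i) (v i) := by
    rintro u v ⟨p⟩
    induction p with
    | nil => rfl
    | @cons a b _ hadj _ ih =>
      refine SimpleGraph.Reachable.trans ?_ ih
      by_cases hab : a i = b i
      · rw [hab]
      · refine SimpleGraph.Adj.reachable ?_
        rw [hH, SimpleGraph.fromEdgeSet_adj]
        exact ⟨⟨s(a, b), ⟨hadj, inDirection_mk.2 hab⟩, rfl⟩, hab⟩
  have hconn : H.Connected :=
    { preconnected := fun a b => by
        simpa using hreach (hT.preconnected (Function.update (fun k => ⟨0, hn k⟩) i a)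
          (Function.update (fun k => ⟨0, hn k⟩) i b))
      nonempty := ⟨⟨0, hn i⟩⟩ }
  have h1 := hconn.card_vert_le_card_edgeSet_add_one
  have h2 : Nat.card H.edgeSet ≤ {e | e ∈ T.edgeSet ∧ InDirection i e}.ncard := by
    rw [Nat.card_coe_set_eq]
    refine (Set.ncard_le_ncard ?_ (Set.toFinite _)).trans
      (Set.ncard_image_le (f := Sym2.map fun v : Vertex n => v i) (Set.toFinite _))
    rw [hH, SimpleGraph.edgeSet_fromEdgeSet]
    exact Set.sdiff_subset
  rw [Nat.card_fin] at h1
  omega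

lemma pow_dvd_ddMonomial (hn : ∀ i, 1 ≤ n i) (hk : ∃ k, 2 ≤ n k) {T : SimpleGraph (Vertex n)}
    (hT : T.Connected) (i : Fin r) (j : Fin (n i)) :
    x n i j ^ (∏ k ∈ univ.erase i, n k) ∣ ddMonomial T := by
  classical
  have : Nontrivial (Vertex n) := by
    obtain ⟨k, hk⟩ := hk
    exact ⟨fun k => ⟨0, hn k⟩, Function.update (fun k => ⟨0, hn k⟩) k ⟨1, hk⟩, fun h => by
      simpa using congrFun h k⟩
  have hcard : #{v : Vertex n | v i = j} = ∏ k ∈ univ.erase i, n k := by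
    have : ({v : Vertex n | v i = j} : Finset _) =
        Fintype.piFinset
        (Function.update (fun k => (univ : Finset (Fin (n k)))) i {j}) := by
      ext v
      simp only [Finset.mem_filter, Finset.mem_univ, true_and, Fintype.mem_piFinset]
      refine ⟨fun h k => ?_, fun h => by simpa using h i⟩
      by_cases hki : k = i
      · subst hki
        simp [h]
      · simp [Function.update_of_ne hki]
    rw [this, Fintype.card_piFinset, ← Finset.mul_prod_erase _ _ (Finset.mem_univ i),
      Function.update_self, Finset.card_singleton, one_mul]
    refine Finset.prod_congr rfl fun k hk => ?_
    rw [Function.update_of_ne (Finset.ne_of_mem_erase hk), Finset.card_univ, Fintype.card_fin]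
  rw [← hcard, ← Finset.prod_const, ddMonomial]
  refine (Finset.prod_dvd_prod_of_dvd _ _ fun v hv => ?_).trans
    (Finset.prod_dvd_prod_of_subset _ _ _ (Finset.subset_univ _))
  rw [← (Finset.mem_filter.1 hv).2]
  exact (Finset.dvd_prod_of_mem (fun i => x n i (v i)) (Finset.mem_univ i)).trans
    (dvd_pow_self _ (hT.preconnected.degree_pos_of_nontrivial v).ne')

/-! ### Divisibility by powers of the sum of the variables of one direction -/

lemma prime_x (i : Fin r) (j : Fin (n i)) : Prime (x n i j) := X_prime

lemma not_x_dvd_sum_x {i : Fin r} {j j' : Fin (n i)} (h : j ≠ j') :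
    ¬ x n i j ∣ ∑ k, x n i k := by
  classical
  intro hdvd
  -- Evaluate the variable of `j'` at `1` and all others at `0`.
  have := map_dvd (aeval fun k : Var n => if k = Sum.inr ⟨i, j'⟩ then (1 : ℤ) else 0) hdvd
  simp [x, h] at this

theorem sum_x_pow_dvd_enumerator (hn : ∀ i, 1 ≤ n i) (i : Fin r) :
    (∑ j, x n i j) ^ (n i - 2) ∣ enumerator n := by
  classical
  rcases lt_or_ge (n i) 2 with hi | hi
  · simp [Nat.sub_eq_zero_of_le hi.le]
  set R := MvPolynomial (Var n) ℤ
  set root : Vertex n := fun k => ⟨0, hn k⟩ with hroot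
  set j₀ : Fin (n i) := root i
  set j₁ : Fin (n i) := ⟨1, hi⟩
  have h01 : j₀ ≠ j₁ := by simp [j₀, j₁, hroot]
  set s : R := ∑ j, x n i j
  let c : Fin (n i) → Fin (n i) → R := fun j k =>
    if k = j then x n i j₁ else if k = j₁ then - x n i j else 0
  -- For `j ≠ j₀, j₁`, the vector `c j` is orthogonal to the variables and vanishes at `j₀`, hence
  -- defines a function of the `i`-th coordinate that vanishes at `root`.
  have hc : ∀ j, j ≠ j₁ → ∑ k, x n i k * c j k = 0 := fun j hj => by
    rw [Finset.sum_eq_add j j₁ hj _ (by simp) (by simp)]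
    · simp [c, hj.symm]
      ring
    · rintro k - ⟨hkj, hk₁⟩
      simp [c, hkj, hk₁]
  -- The vertices that index the `n i - 2` columns of `P` holding these functions.
  let J : Finset {v // v ≠ root} := {v | v.1 = Function.update root i (v.1 i) ∧ v.1 i ≠ j₁}
  have hJ : #J = n i - 2 := by
    have : #((univ.erase j₀).erase j₁) = n i - 2 := by
      rw [Finset.card_erase_of_mem (by simp [h01.symm]), Finset.card_erase_of_mem (by simp),
        Finset.card_univ, Fintype.card_fin, Nat.sub_sub]
    rw [← this]
    refine Finset.card_bij (fun v _ => v.1 i) ?_ ?_ ?_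
    · rintro ⟨v, hv⟩ hvJ
      simp only [J, Finset.mem_filter, Finset.mem_univ, true_and] at hvJ
      simp only [Finset.mem_erase, Finset.mem_univ, and_true]
      refine ⟨hvJ.2, fun h => hv ?_⟩
      rw [hvJ.1, h, Function.update_eq_self]
    · rintro ⟨v, hv⟩ hvJ ⟨v', hv'⟩ hvJ' h
      simp only [J, Finset.mem_filter, Finset.mem_univ, true_and] at hvJ hvJ'
      refine Subtype.ext ?_
      simp only at h ⊢
      rw [hvJ.1, hvJ'.1, h]
    · intro j hj
      simp only [Finset.mem_erase, Finset.mem_univ, and_true] at hj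
      refine ⟨⟨Function.update root i j, fun h => hj.2 ?_⟩, ?_, by simp⟩
      · simpa [j₀] using congrFun h i
      · simp [J, hj.1]
  let L : Matrix {v // v ≠ root} {v // v ≠ root} R :=
    reducedLaplacian (fun u v => edgeWeight n s(u, v)) root
  let P : Matrix {v // v ≠ root} {v // v ≠ root} R := Matrix.of fun u v =>
    if v ∈ J then c (v.1 i) (u.1 i) else if u = v then 1 else 0
  have hdetP : P.det = x n i j₁ ^ #J := by
    -- The rows in `J` vanish off the columns in `J`, where they form `x n i j₁` times the identity.
    rw [Matrix.twoBlockTriangular_det P (· ∉ J)]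
    · have h1 : P.toSquareBlockProp (· ∉ J) = 1 := by
        ext ⟨u, hu⟩ ⟨v, hv⟩
        simp [P, Matrix.toSquareBlockProp_def, hv, Matrix.one_apply]
      have h2 : P.toSquareBlockProp (fun v => ¬ v ∉ J) = Matrix.diagonal fun _ => x n i j₁ := by
        ext ⟨u, hu⟩ ⟨v, hv⟩ : 2
        rw [not_not] at hu hv
        have hu' := hu
        have hv' := hv
        simp only [J, Finset.mem_filter, Finset.mem_univ, true_and] at hu' hv'
        have huv : u.1 i = v.1 i ↔ u = v := by
          refine ⟨fun h => Subtype.ext ?_, fun h => by rw [h]⟩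
          rw [hu'.1, hv'.1, h]
        simp [P, Matrix.toSquareBlockProp_def, hv, Matrix.diagonal_apply, c, huv, hu'.2]
      rw [h1, h2, Matrix.det_one, one_mul, Matrix.det_diagonal, Finset.prod_const,
        Finset.card_univ, Fintype.card_subtype]
      congr 2
      ext v
      simp
    · intro u hu v hv
      rw [not_not] at hu
      have huv : u ≠ v := by rintro rfl; exact hv hu
      simp [P, hv, huv]
  have hdvd : s ^ #J ∣ (L * P).det := by
    refine pow_card_dvd_det _ _ _ fun v hv u => ?_
    have hv' := hv
    simp only [J, Finset.mem_filter, Finset.mem_univ, true_and] at hv'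
    have hvr : root i ≠ v.1 i := fun h => v.2 (by
      rw [hv'.1, ← h, Function.update_eq_self])
    have h : (L * P) u v = L.mulVec (fun z => c (v.1 i) (z.1 i)) u := by
      simp [Matrix.mul_apply, Matrix.mulVec, dotProduct, P, hv]
    rw [h, reducedLaplacian_mulVec _ (fun z : Vertex n => c (v.1 i) (z i))
      (by simp only [c]; rw [if_neg hvr, if_neg h01]), sum_edgeWeight_mul_sub u.1 i, hc _ hv'.2,
      sub_zero]
    exact (dvd_mul_right _ _).mul_left _
  rw [Matrix.det_mul, hdetP, ← enumerator_eq_det, mul_comm, hJ] at hdvd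
  obtain ⟨t, ht⟩ := hdvd
  -- The factor `det P` is coprime to `s`, so it can be cancelled.
  have hcop : ¬ x n i j₁ ∣ s ^ (n i - 2) := fun h =>
    not_x_dvd_sum_x h01.symm ((prime_x i j₁).dvd_of_dvd_pow h)
  obtain ⟨t', ht'⟩ := (prime_x i j₁).pow_dvd_of_dvd_mul_left (n i - 2) hcop
    (Dvd.intro _ ht)
  refine ⟨t', mul_right_cancel₀ (pow_ne_zero (n i - 2) (prime_x i j₁).ne_zero) ?_⟩
  rw [mul_comm, ht, ht']
  ring

end Enumerator
end ProductTrees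

theorem theorem1p2 {r : ℕ} (n : Fin r → ℕ) (hn : ∀ i, 1 ≤ n i) :
    (∀ i : Fin r, ProductTrees.q n i ^ (n i - 1) ∣ ProductTrees.enumerator n) ∧
    ((∃ k : Fin r, 2 ≤ n k) → ∀ (i : Fin r) (j : Fin (n i)),
      ProductTrees.x n i j ^ (∏ k ∈ Finset.univ.erase i, n k) ∣ ProductTrees.enumerator n) ∧
    (∀ i : Fin r,
      (∑ j : Fin (n i), ProductTrees.x n i j) ^ (n i - 2) ∣ ProductTrees.enumerator n) := by
  have hconn : ∀ T ∈ ProductTrees.spanningTrees (ProductTrees.prodComplete n), T.Connected := by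
    intro T hT
    simp only [ProductTrees.spanningTrees, Set.Finite.mem_toFinset, Set.mem_ofPred_eq] at hT
    exact hT.2.connected
  refine ⟨fun i => ?_, fun hk i j => ?_, ProductTrees.sum_x_pow_dvd_enumerator hn⟩
  · refine Finset.dvd_sum fun T hT => Dvd.dvd.mul_right ?_ _
    exact (pow_dvd_pow _ (ProductTrees.sub_one_le_ncard_inDirection hn (hconn T hT) i)).trans
      (Finset.dvd_prod_of_mem (fun i => ProductTrees.q n i ^
        {e : Sym2 (ProductTrees.Vertex n) | e ∈ T.edgeSet ∧ ProductTrees.InDirection i e}.ncard)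
        (Finset.mem_univ i))
  · exact Finset.dvd_sum fun T hT =>
      (ProductTrees.pow_dvd_ddMonomial hn hk (hconn T hT) i j).mul_left _
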